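/- Let $X$ be a nonempty, convex and compact subset of a (real) Hausdorff locally convex topological vector space $E$, and let $A : X \to 2^X$ and $P : X \times X \to 2^X$ be correspondences (set-valued maps, values possibly empty) such that: (a) $A(x)$ is nonempty and convex for every $x \in X$, and $A$ has open lower sections, i.e. $\{x \in X : y \in A(x)\}$ is open in $X$ for every $y \in X$; (b) for every $x \in X$ the set $\{y \in X : A(x) \cap P(x,y) = \emptyset\} \cap A(x)$ is nonempty; (c) for every $x \in X$ the set $\{y \in X : A(x) \cap P(x,y) = \emptyset\}$ is convex; (d) for every $y \in X$ the set $\{x \in X : A(x) \cap P(x,y) = \emptyset\}$ is open in $X$. Then there exists $x^* \in X$ such that $x^* \in A(x^*)$ and $A(x^*) \cap P(x^*,x^*) = \emptyset$. -/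

import Mathlib

/-- A subset `S` of (the subtype of) a set `X` in a real vector space `E` is convex
if it is convex as a subset of `E`. -/
def ConvexIn {E : Type*} [AddCommGroup E] [Module ℝ E] {X : Set E} (S : Set X) : Prop :=
  Convex ℝ (Subtype.val '' S : Set E)

/-! The map `F x = {y | A x ∩ P (x, y) = ∅} ∩ A x` has nonempty convex values and open lower
sections, so Browder's theorem applies to it. For that theorem, compactness gives finitely many
points `y i` whose lower sections cover `X`. Pulled back along `z ↦ ∑ z i • y i` they cover a
simplex, and `stdSimplex.exists_forall_mem_of_isOpen_cover` finds `z` lying in every member indexed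
by its support; the image of `z` is then a convex combination of points of its own value. The
covering lemma plays the role of Brouwer's theorem: a fine grid is labelled through a Lebesgue
number, and Scarf's lemma `exists_rankDominant_image_eq_univ`, a parity count without
triangulations, yields a small cell carrying all labels of a face. -/

/-! ### Dominant sets and Scarf's lemma -/

section Dominance

variable {ι T α : Type*} [LinearOrder α]

/-- A finite set `σ` is dominant for a family of rankings `r` if no point lies strictly above
some point of `σ` in every ranking. -/
def RankDominant (r : ι → T → α) (σ : Finset T) : Prop :=
  ∀ y, ∃ i, ∀ x ∈ σ, r i y ≤ r i x

theorem RankDominant.mono {r : ι → T → α} {σ τ : Finset T} (h : RankDominant r σ) (hτ : τ ⊆ σ) :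
    RankDominant r τ := fun y => (h y).imp fun _ hi x hx => hi x (hτ hx)

theorem exists_rank_min (r : ι → T → α) {σ : Finset T} (hσ : σ.Nonempty) :
    ∃ m : ι → T, (∀ i, m i ∈ σ) ∧ ∀ i, ∀ x ∈ σ, r i (m i) ≤ r i x := by
  choose m hm using fun i => σ.exists_min_image (r i) hσ
  exact ⟨m, fun i => (hm i).1, fun i => (hm i).2⟩

theorem RankDominant.exists_eq_min {r : ι → T → α} (hr : ∀ i, Function.Injective (r i))
    {σ : Finset T} (h : RankDominant r σ) {m : ι → T} (hm : ∀ i, m i ∈ σ)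
    {y : T} (hy : y ∈ σ) (hle : ∀ i, ∀ x ∈ σ, r i (m i) ≤ r i x) : ∃ i, m i = y := by
  obtain ⟨i, hi⟩ := h y
  exact ⟨i, hr i (le_antisymm (hle i y hy) (hi _ (hm i)))⟩

/-- Each point of a dominant set is the minimum of some ranking; equal cardinalities make this
surjection a bijection. -/
theorem RankDominant.min_injective [Fintype ι] {r : ι → T → α}
    (hr : ∀ i, Function.Injective (r i)) {σ : Finset T} (h : RankDominant r σ)
    (hcard : σ.card = Fintype.card ι) {m : ι → T} (hm : ∀ i, m i ∈ σ)
    (hle : ∀ i, ∀ x ∈ σ, r i (m i) ≤ r i x) : Function.Injective m := by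
  have hs : Function.Surjective (fun i => (⟨m i, hm i⟩ : σ)) := by
    rintro ⟨y, hy⟩
    obtain ⟨i, hi⟩ := h.exists_eq_min hr hm hy hle
    exact ⟨i, Subtype.ext hi⟩
  have hb := (Fintype.bijective_iff_surjective_and_card _).2 ⟨hs, by simp [hcard]⟩
  exact fun i j hij => hb.1 (Subtype.ext hij)

open Classical in
/-- The points lying above the minima `m` in every ranking other than the `i`-th one. -/
noncomputable def aboveExcept [Fintype T] (r : ι → T → α) (m : ι → T) (i : ι) : Finset T :=
  {y | ∀ k, k ≠ i → r k (m k) < r k y}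

open Classical in
/-- The points of `aboveExcept r m i` that are maximal in the `i`-th ranking. -/
noncomputable def topExcept [Fintype T] (r : ι → T → α) (m : ι → T) (i : ι) : Finset T :=
  {y ∈ aboveExcept r m i | ∀ z ∈ aboveExcept r m i, r i z ≤ r i y}

theorem mem_aboveExcept [Fintype T] {r : ι → T → α} {m : ι → T} {i : ι} {y : T} :
    y ∈ aboveExcept r m i ↔ ∀ k, k ≠ i → r k (m k) < r k y := by
  simp [aboveExcept]

theorem card_topExcept [Fintype T] {r : ι → T → α} (hr : ∀ i, Function.Injective (r i))
    {m : ι → T} {i : ι} (h : (aboveExcept r m i).Nonempty) : (topExcept r m i).card = 1 := by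
  obtain ⟨y, hy, hmax⟩ := (aboveExcept r m i).exists_max_image (r i) h
  rw [Finset.card_eq_one]
  refine ⟨y, ?_⟩
  ext z
  simp only [topExcept, Finset.mem_filter, Finset.mem_singleton]
  constructor
  · rintro ⟨hz, hz'⟩
    exact hr i (le_antisymm (hmax z hz) (hz' y hy))
  · rintro rfl
    exact ⟨hy, hmax⟩

theorem topExcept_eq_empty [Fintype T] {r : ι → T → α} {m : ι → T} {i : ι}
    (h : aboveExcept r m i = ∅) : topExcept r m i = ∅ := by
  simp [topExcept, h]

open Classical in
/-- A dominant set with one point fewer than there are rankings has two rankings `i`, `j` with the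
same minimum; its dominant one-point extensions are the tops above it except in `i` or in `j`. -/
theorem RankDominant.extensions_eq [Fintype ι] [Fintype T] {r : ι → T → α}
    (hr : ∀ i, Function.Injective (r i)) {τ : Finset T} (h : RankDominant r τ)
    (hcard : τ.card + 1 = Fintype.card ι) {m : ι → T} (hm : ∀ i, m i ∈ τ)
    (hle : ∀ i, ∀ x ∈ τ, r i (m i) ≤ r i x) {i j : ι} (hij : i ≠ j) (hmij : m i = m j) :
    ({y | y ∉ τ ∧ RankDominant r (insert y τ)} : Finset T) = topExcept r m i ∪ topExcept r m j := by
  have back : ∀ i j : ι, i ≠ j → m i = m j → ∀ y ∈ topExcept r m i,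
      y ∉ τ ∧ RankDominant r (insert y τ) := by
    intro i j hij hmij y hy
    simp only [topExcept, Finset.mem_filter, mem_aboveExcept] at hy
    obtain ⟨hy, hmax⟩ := hy
    refine ⟨fun hyτ => ?_, fun z => ?_⟩
    · obtain ⟨l, rfl⟩ := h.exists_eq_min hr hm hyτ hle
      by_cases hl : l = i
      · subst hl
        exact lt_irrefl _ (hmij ▸ hy j hij.symm)
      · exact lt_irrefl _ (hy l hl)
    -- Such a `z` would lie in `aboveExcept r m i`, hence not above `y` in ranking `i`, where `y` is
    -- lowest.
    · by_contra! hz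
      have hyi : ∀ x ∈ τ, r i y ≤ r i x := by
        obtain ⟨l, hl⟩ := h y
        by_cases hli : l = i
        · exact hli ▸ hl
        · exact absurd (hy l hli) (hl _ (hm l)).not_gt
      have hzM : ∀ k, k ≠ i → r k (m k) < r k z := by
        intro k hk
        obtain ⟨x, hx, hxz⟩ := hz k
        rcases Finset.mem_insert.1 hx with rfl | hx
        · exact (hy k hk).trans hxz
        · exact (hle k x hx).trans_lt hxz
      obtain ⟨x, hx, hxz⟩ := hz i
      have hzy := hmax z hzM
      rcases Finset.mem_insert.1 hx with rfl | hx
      · exact hxz.not_ge hzy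
      · exact hxz.not_ge (hzy.trans (hyi x hx))
  ext y
  simp only [Finset.mem_filter, Finset.mem_univ, true_and, Finset.mem_union]
  constructor
  · rintro ⟨hyτ, hdom⟩
    obtain ⟨m', hm', hle'⟩ := exists_rank_min r (Finset.insert_nonempty y τ)
    have hinj := hdom.min_injective hr (by rw [Finset.card_insert_of_notMem hyτ, hcard]) hm' hle'
    obtain ⟨k, hk⟩ := hdom.exists_eq_min hr hm' (Finset.mem_insert_self y τ) hle'
    -- The new point is the minimum of ranking `k` alone, so the other minima are unchanged; as the
    -- new minima are distinct, `k` is `i` or `j`.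
    have hne : ∀ l, l ≠ k → m' l = m l := by
      intro l hl
      have hmem : m' l ∈ τ := by
        rcases Finset.mem_insert.1 (hm' l) with h1 | h1
        · exact absurd (hinj (h1.trans hk.symm)) hl
        · exact h1
      exact hr l (le_antisymm (hle' l _ (Finset.mem_insert_of_mem (hm l))) (hle l _ hmem))
    have hyM : ∀ l, l ≠ k → r l (m l) < r l y := by
      intro l hl
      refine lt_of_le_of_ne (hne l hl ▸ hle' l y (Finset.mem_insert_self y τ)) fun heq => ?_
      exact hyτ (hr l heq ▸ hm l)
    have htop : y ∈ topExcept r m k := by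
      simp only [topExcept, Finset.mem_filter, mem_aboveExcept]
      refine ⟨hyM, fun z hz => ?_⟩
      obtain ⟨l, hl⟩ := hdom z
      by_cases hlk : l = k
      · exact hlk ▸ hl y (Finset.mem_insert_self y τ)
      · exact absurd (hz l hlk) (hl _ (Finset.mem_insert_of_mem (hm l))).not_gt
    by_cases hki : k = i
    · exact Or.inl (hki ▸ htop)
    by_cases hkj : k = j
    · exact Or.inr (hkj ▸ htop)
    exact absurd (hinj ((hne i (Ne.symm hki)).trans (hmij.trans (hne j (Ne.symm hkj)).symm))) hij
  · rintro (hy | hy)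
    · exact back i j hij hmij y hy
    · exact back j i hij.symm hmij.symm y hy

theorem RankDominant.disjoint_topExcept [Fintype T] {r : ι → T → α} {τ : Finset T}
    (h : RankDominant r τ) {m : ι → T} (hm : ∀ i, m i ∈ τ) {i j : ι} (hij : i ≠ j) :
    Disjoint (topExcept r m i) (topExcept r m j) := by
  rw [Finset.disjoint_left]
  intro y hy hy'
  simp only [topExcept, Finset.mem_filter, mem_aboveExcept] at hy hy'
  obtain ⟨l, hl⟩ := h y
  have hlt : r l (m l) < r l y := by
    by_cases hli : l = i
    · exact hy'.1 l (hli ▸ hij)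
    · exact hy.1 l hli
  exact hlt.not_ge (hl _ (hm l))

open Classical in
theorem card_supersets_eq_card_extensions [Fintype T] (τ : Finset T) (p : Finset T → Prop) :
    ({σ | σ.card = τ.card + 1 ∧ p σ ∧ τ ⊆ σ} : Finset (Finset T)).card
      = ({y | y ∉ τ ∧ p (insert y τ)} : Finset T).card := by
  symm
  refine Finset.card_bij (fun y _ => insert y τ) ?_ ?_ ?_
  · intro y hy
    simp only [Finset.mem_filter, Finset.mem_univ, true_and] at hy ⊢
    exact ⟨Finset.card_insert_of_notMem hy.1, hy.2, Finset.subset_insert y τ⟩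
  · intro y hy z hz hyz
    simp only [Finset.mem_filter, Finset.mem_univ, true_and] at hy hz
    have : y ∈ insert z τ := hyz ▸ Finset.mem_insert_self y τ
    exact (Finset.mem_insert.1 this).resolve_right hy.1
  · intro σ hσ
    simp only [Finset.mem_filter, Finset.mem_univ, true_and] at hσ
    obtain ⟨hc, hp, hsub⟩ := hσ
    obtain ⟨y, hy, rfl⟩ := Finset.exists_eq_insert_iff.2 ⟨hsub, hc.symm⟩
    exact ⟨y, by simpa using ⟨hy, hp⟩, rfl⟩

open Classical in
/-- A set with as many points as labels, not all of which occur on it, has an even number of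
facets carrying exactly the labels other than `i₀`. -/
theorem even_card_facets_of_image_ne_univ [Fintype ι] [Fintype T] (l : T → ι) (i₀ : ι)
    {σ : Finset T} (hcard : σ.card = Fintype.card ι) (hσ : σ.image l ≠ Finset.univ) :
    Even ({τ | τ ⊆ σ ∧ τ.card + 1 = Fintype.card ι ∧ τ.image l = Finset.univ.erase i₀} :
      Finset (Finset T)).card := by
  by_cases hex : ∃ τ : Finset T, τ ⊆ σ ∧ τ.card + 1 = Fintype.card ι ∧
      τ.image l = Finset.univ.erase i₀
  swap
  · rw [Finset.card_eq_zero.2]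
    · exact Even.zero
    · rw [Finset.filter_eq_empty_iff]
      exact fun τ _ h => hex ⟨τ, h⟩
  obtain ⟨τ, hτσ, hτc, hτ⟩ := hex
  obtain ⟨y, hy, rfl⟩ := Finset.exists_eq_insert_iff.2 ⟨hτσ, hτc.trans hcard.symm⟩
  have hcimg : (τ.image l).card = τ.card := by
    rw [hτ, Finset.card_erase_of_mem (Finset.mem_univ _), Finset.card_univ]; omega
  have hinj := Finset.card_image_iff.1 hcimg
  have hly : l y ≠ i₀ := by
    intro hly
    apply hσ
    rw [Finset.image_insert, hτ, hly, Finset.insert_erase (Finset.mem_univ _)]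
  have hmem : l y ∈ τ.image l := by rw [hτ]; exact Finset.mem_erase.2 ⟨hly, Finset.mem_univ _⟩
  obtain ⟨z, hz, hzy⟩ := Finset.mem_image.1 hmem
  have hyz : y ≠ z := fun h => hy (h ▸ hz)
  -- Only `y` and `z` share a label, so only their removal loses no label.
  suffices hS : ({τ' | τ' ⊆ insert y τ ∧ τ'.card + 1 = Fintype.card ι ∧
      τ'.image l = Finset.univ.erase i₀} : Finset (Finset T))
      = {(insert y τ).erase y, (insert y τ).erase z} by
    rw [hS, Finset.card_pair]
    · exact even_two
    · intro h
      have : z ∈ (insert y τ).erase y := Finset.mem_erase.2 ⟨hyz.symm, Finset.mem_insert_of_mem hz⟩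
      rw [h] at this
      exact (Finset.mem_erase.1 this).1 rfl
  ext τ'
  simp only [Finset.mem_filter, Finset.mem_univ, true_and, Finset.mem_insert,
    Finset.mem_singleton]
  constructor
  · rintro ⟨hs, hc, him⟩
    obtain ⟨x, hx, hxe⟩ := Finset.exists_eq_insert_iff.2 ⟨hs, hc.trans hcard.symm⟩
    have hτ' : τ' = (insert y τ).erase x := by rw [← hxe, Finset.erase_insert hx]
    have hxm : x ∈ insert y τ := hxe ▸ Finset.mem_insert_self x τ'
    by_cases hxy : x = y
    · left; rw [hτ', hxy]
    by_cases hxz : x = z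
    · right; rw [hτ', hxz]
    exfalso
    have hxτ : x ∈ τ := (Finset.mem_insert.1 hxm).resolve_left hxy
    have : l x ∈ τ'.image l := by
      rw [him, ← hτ]; exact Finset.mem_image_of_mem l hxτ
    obtain ⟨w, hw, hwx⟩ := Finset.mem_image.1 this
    have hwx' : w ≠ x := fun h => hx (h ▸ hw)
    rcases Finset.mem_insert.1 (hs hw) with rfl | hwτ
    · exact hxz (hinj hxτ hz (hwx.symm.trans hzy.symm))
    · exact hwx' (hinj hwτ hxτ hwx)
  · have hc : ∀ x ∈ insert y τ, ((insert y τ).erase x).card + 1 = Fintype.card ι := fun x hx => by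
      rw [Finset.card_erase_add_one hx, hcard]
    rintro (rfl | rfl)
    · exact ⟨Finset.erase_subset _ _, hc y (Finset.mem_insert_self y τ),
        by rw [Finset.erase_insert hy, hτ]⟩
    · refine ⟨Finset.erase_subset _ _, hc z (Finset.mem_insert_of_mem hz), ?_⟩
      rw [← hτ]
      rw [Finset.erase_insert_of_ne hyz, Finset.image_insert, ← hzy, ← Finset.image_insert,
        Finset.insert_erase hz]

open Classical in
/-- **Scarf's lemma** in the presence of slack points `e i`, each minimal in its own ranking and
above all proper points in the others: some dominant set carries every label. -/
theorem exists_rankDominant_image_eq_univ [Fintype ι] [Nontrivial ι] [Fintype T] {r : ι → T → α}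
    (hr : ∀ i, Function.Injective (r i)) (e : ι → T)
    (hmin : ∀ i y, r i (e i) ≤ r i y)
    (hmax : ∀ i j y, j ≠ i → y ∉ Set.range e → r j y < r j (e i))
    (hproper : ∃ t, t ∉ Set.range e) (l : T → ι) (hl : ∀ i, l (e i) = i) :
    ∃ σ : Finset T, σ.card = Fintype.card ι ∧ RankDominant r σ ∧ σ.image l = Finset.univ := by
  by_contra! hno
  obtain ⟨i₀⟩ := (inferInstance : Nonempty ι)
  have hone : 1 < Fintype.card ι := Fintype.one_lt_card
  have he : Function.Injective e := Function.LeftInverse.injective hl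
  set R : Finset (Finset T) := {σ | σ.card = Fintype.card ι ∧ RankDominant r σ} with hR
  set D : Finset (Finset T) := {τ | τ.card + 1 = Fintype.card ι ∧ RankDominant r τ ∧
    τ.image l = Finset.univ.erase i₀} with hD
  -- Incidences are even counted from `R`, but odd from `D`: two per `τ ≠ τ₀`, one for `τ₀`.
  have hcount := Finset.sum_card_bipartiteAbove_eq_sum_card_bipartiteBelow
    (fun τ σ : Finset T => τ ⊆ σ) (s := D) (t := R)
  have heven : Even (∑ σ ∈ R, (Finset.bipartiteBelow (fun τ σ : Finset T => τ ⊆ σ) D σ).card) := by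
    refine Finset.even_sum _ fun σ hσ => ?_
    simp only [hR, Finset.mem_filter, Finset.mem_univ, true_and] at hσ
    suffices heq : Finset.bipartiteBelow (fun τ σ : Finset T => τ ⊆ σ) D σ =
        ({τ | τ ⊆ σ ∧ τ.card + 1 = Fintype.card ι ∧ τ.image l = Finset.univ.erase i₀} :
          Finset (Finset T)) by
      rw [heq]
      exact even_card_facets_of_image_ne_univ l i₀ hσ.1 (hno σ hσ.1 hσ.2)
    ext τ
    simp only [Finset.bipartiteBelow, hD, Finset.mem_filter, Finset.mem_univ, true_and]
    constructor
    · rintro ⟨⟨h1, -, h3⟩, h4⟩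
      exact ⟨h4, h1, h3⟩
    · rintro ⟨h4, h1, h3⟩
      exact ⟨⟨h1, hσ.2.mono h4, h3⟩, h4⟩
  set τ₀ : Finset T := (Finset.univ.erase i₀).image e with hτ₀
  have hτ₀D : τ₀ ∈ D := by
    simp only [hD, Finset.mem_filter, Finset.mem_univ, true_and]
    refine ⟨?_, fun y => ?_, ?_⟩
    · rw [hτ₀, Finset.card_image_of_injective _ he,
        Finset.card_erase_add_one (Finset.mem_univ _), Finset.card_univ]
    · by_cases hy : y ∈ Set.range e
      · obtain ⟨p, rfl⟩ := hy
        exact ⟨p, fun x _ => hmin p x⟩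
      · refine ⟨i₀, fun x hx => ?_⟩
        obtain ⟨p, hp, rfl⟩ := Finset.mem_image.1 hx
        exact (hmax p i₀ y (Finset.ne_of_mem_erase hp).symm hy).le
    · rw [hτ₀, Finset.image_image]
      simp [Function.comp_def, hl]
  have hsplit : ∀ τ ∈ D, ∃ m : ι → T, (∀ i, m i ∈ τ) ∧ (∀ i, ∀ x ∈ τ, r i (m i) ≤ r i x) ∧
      ∃ i j, i ≠ j ∧ m i = m j ∧ (Finset.bipartiteAbove (fun τ σ : Finset T => τ ⊆ σ) R τ).card
        = (topExcept r m i).card + (topExcept r m j).card := by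
    intro τ hτ
    simp only [hD, Finset.mem_filter, Finset.mem_univ, true_and] at hτ
    obtain ⟨hc, hdom, him⟩ := hτ
    have hne : τ.Nonempty := Finset.card_pos.1 (by omega)
    obtain ⟨m, hm, hle⟩ := exists_rank_min r hne
    obtain ⟨i, -, j, -, hij, hmij⟩ := Finset.exists_ne_map_eq_of_card_lt_of_maps_to
      (s := (Finset.univ : Finset ι)) (t := τ) (f := m) (by rw [Finset.card_univ]; omega)
      (fun i _ => hm i)
    refine ⟨m, hm, hle, i, j, hij, hmij, ?_⟩
    rw [← Finset.card_union_of_disjoint (hdom.disjoint_topExcept hm hij),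
      ← hdom.extensions_eq hr hc hm hle hij hmij, ← card_supersets_eq_card_extensions]
    congr 1
    ext σ
    simp only [Finset.bipartiteAbove, hR, Finset.mem_filter, Finset.mem_univ, true_and, hc,
      and_assoc]
  have htwo : ∀ τ ∈ D, τ ≠ τ₀ →
      (Finset.bipartiteAbove (fun τ σ : Finset T => τ ⊆ σ) R τ).card = 2 := by
    intro τ hτ hne
    obtain ⟨m, hm, hle, i, j, hij, hmij, hcard⟩ := hsplit τ hτ
    simp only [hD, Finset.mem_filter, Finset.mem_univ, true_and] at hτ
    obtain ⟨hc, hdom, him⟩ := hτ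
    obtain ⟨t, htτ, ht⟩ : ∃ t ∈ τ, t ∉ Set.range e := by
      by_contra! hall
      apply hne
      rw [hτ₀, ← him, Finset.image_image]
      ext x
      simp only [Finset.mem_image, Function.comp_apply]
      constructor
      · intro hx
        obtain ⟨p, rfl⟩ := hall x hx
        exact ⟨e p, hx, by rw [hl]⟩
      · rintro ⟨a, ha, rfl⟩
        obtain ⟨p, rfl⟩ := hall a ha
        rwa [hl]
    have habove : ∀ i, (aboveExcept r m i).Nonempty := fun i =>
      ⟨e i, mem_aboveExcept.2 fun k hk => (hle k t htτ).trans_lt (hmax i k t hk ht)⟩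
    rw [hcard, card_topExcept hr (habove i), card_topExcept hr (habove j)]
  have hslack : (Finset.bipartiteAbove (fun τ σ : Finset T => τ ⊆ σ) R τ₀).card = 1 := by
    obtain ⟨m, hm, hle, i, j, hij, hmij, hcard⟩ := hsplit τ₀ hτ₀D
    have hmk : ∀ k, k ≠ i₀ → m k = e k := fun k hk => hr k <| le_antisymm
      (hle k _ (Finset.mem_image_of_mem e (Finset.mem_erase.2 ⟨hk, Finset.mem_univ k⟩))) (hmin k _)
    have hnear : (aboveExcept r m i₀).Nonempty := by
      obtain ⟨t, ht⟩ := hproper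
      refine ⟨t, mem_aboveExcept.2 fun k hk => ?_⟩
      rw [hmk k hk]
      exact lt_of_le_of_ne (hmin k t) fun h => ht ⟨k, hr k h⟩
    -- A member would be above `e p` in ranking `i₀`, so another slack point `e q`, which is not
    -- above itself in ranking `q`.
    have hfar : ∀ p, p ≠ i₀ → m i₀ = m p → aboveExcept r m p = ∅ := by
      intro p hp hmp
      rw [Finset.eq_empty_iff_forall_notMem]
      intro y hy
      rw [mem_aboveExcept] at hy
      have hy₀ := hy i₀ hp.symm
      rw [hmp, hmk p hp] at hy₀
      by_cases hye : y ∈ Set.range e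
      · obtain ⟨q, rfl⟩ := hye
        by_cases hq₀ : q = i₀
        · subst hq₀
          exact hy₀.not_ge (hmin q _)
        by_cases hqp : q = p
        · subst hqp
          exact lt_irrefl _ hy₀
        · have := hy q hqp
          rw [hmk q hq₀] at this
          exact lt_irrefl _ this
      · exact lt_asymm hy₀ (hmax p i₀ y hp.symm hye)
    rw [hcard]
    by_cases hi : i = i₀
    · subst hi
      rw [card_topExcept hr hnear, topExcept_eq_empty (hfar j hij.symm hmij), Finset.card_empty]
    by_cases hj : j = i₀
    · subst hj
      rw [card_topExcept hr hnear, topExcept_eq_empty (hfar i hij hmij.symm), Finset.card_empty]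
    · rw [hmk i hi, hmk j hj] at hmij
      exact absurd (he hmij) hij
  rw [← hcount, ← Finset.add_sum_erase D _ hτ₀D, hslack] at heven
  have heven' : Even (∑ τ ∈ D.erase τ₀,
      (Finset.bipartiteAbove (fun τ σ : Finset T => τ ⊆ σ) R τ).card) :=
    Finset.even_sum _ fun τ hτ => by
      rw [htwo τ (Finset.mem_of_mem_erase hτ) (Finset.ne_of_mem_erase hτ)]
      exact even_two
  rcases heven with ⟨a, ha⟩
  rcases heven' with ⟨b, hb⟩
  omega

end Dominance

/-! ### Labelled grids and open covers of the simplex -/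

section Simplex

variable {ι : Type*} [Fintype ι]

open Classical in
/-- A labelling of the grid of natural vectors with coordinate sum `N` has a small cell carrying
exactly the labels `i` in the support of some grid point `z`. -/
theorem exists_grid_point_near_labels [Nontrivial ι] (N : ℕ) (l : (ι → ℕ) → ι) :
    ∃ z : ι → ℕ, ∑ i, z i = N ∧ ∀ i, z i ≠ 0 → ∃ x : ι → ℕ, ∑ i, x i = N ∧ l x = i ∧
      ∀ k, z k ≤ x k + Fintype.card ι ∧ x k ≤ z k + Fintype.card ι := by
  let G := {x : ι → ℕ // x ∈ Finset.piAntidiag (Finset.univ : Finset ι) N}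
  have hG : ∀ x : ι → ℕ, x ∈ Finset.piAntidiag (Finset.univ : Finset ι) N ↔ ∑ i, x i = N := by
    intro x; simp [Finset.mem_piAntidiag]
  let c := Fintype.equivFin (G ⊕ ι)
  -- Grid weights lie in `[1, N + 1]`, strictly between the slack values `0` and `N + 2`; `c` breaks
  -- ties.
  let w : ι → G ⊕ ι → ℕ := fun i =>
    Sum.elim (fun x => x.1 i + 1) (fun k => if k = i then 0 else N + 2)
  let r : ι → G ⊕ ι → ℕ ×ₗ ℕ := fun i t => toLex (w i t, (c t : ℕ))
  have hr : ∀ i, Function.Injective (r i) := fun i s t hst => by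
    have := congrArg (fun p => (ofLex p).2) hst
    exact c.injective (Fin.ext this)
  have hlt : ∀ i s t, w i s < w i t → r i s < r i t := fun i s t h => by
    rw [Prod.Lex.toLex_lt_toLex]; exact Or.inl h
  have hwle : ∀ i s t, r i s ≤ r i t → w i s ≤ w i t := fun i s t h => by
    by_contra! hh
    exact (hlt i t s hh).not_ge h
  have hcoord : ∀ (x : ι → ℕ), ∑ i, x i = N → ∀ i, x i ≤ N := fun x hx i =>
    hx ▸ Finset.single_le_sum (fun _ _ => Nat.zero_le _) (Finset.mem_univ i)
  obtain ⟨i₁⟩ := (inferInstance : Nonempty ι)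
  have hsingle : ∑ i, (Pi.single i₁ N : ι → ℕ) i = N := by simp
  obtain ⟨σ, hσc, hdom, hσl⟩ := exists_rankDominant_image_eq_univ hr (Sum.inr : ι → G ⊕ ι)
    (fun i y => by
      rcases eq_or_ne y (Sum.inr i) with rfl | hy
      · exact le_rfl
      · refine (hlt i _ _ ?_).le
        rcases y with x | k
        · simp [w]
        · have : k ≠ i := fun h => hy (by rw [h])
          simp [w, this])
    (fun i j y hji hy => by
      refine hlt j _ _ ?_
      rcases y with x | k
      · have := hcoord x.1 ((hG _).1 x.2) j
        simp [w, hji.symm]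
        omega
      · exact absurd ⟨k, rfl⟩ hy)
    ⟨Sum.inl ⟨Pi.single i₁ N, (hG _).2 hsingle⟩, by simp⟩
    (Sum.elim (fun x => l x.1) id) (fun i => rfl)
  set C : Finset ι := {i | Sum.inr i ∉ σ} with hC
  have hCmem : ∀ i, i ∈ C ↔ Sum.inr i ∉ σ := fun i => by simp [hC]
  have hlab : ∀ i ∈ C, ∃ x : G, Sum.inl x ∈ σ ∧ l x.1 = i := by
    intro i hi
    have : i ∈ σ.image (Sum.elim (fun x : G => l x.1) id) := by
      rw [hσl]
      exact Finset.mem_univ i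
    obtain ⟨t, ht, hti⟩ := Finset.mem_image.1 this
    rcases t with x | k
    · exact ⟨x, ht, hti⟩
    · simp only [Sum.elim_inr, id] at hti
      exact absurd (hti ▸ ht) ((hCmem i).1 hi)
  have hdomG : ∀ y : ι → ℕ, ∑ i, y i = N → ∃ i ∈ C, ∀ x : G, Sum.inl x ∈ σ → y i ≤ x.1 i := by
    intro y hy
    obtain ⟨i, hi⟩ := hdom (Sum.inl ⟨y, (hG y).2 hy⟩)
    refine ⟨i, (hCmem i).2 fun hmem => ?_, fun x hx => ?_⟩
    · have := hwle _ _ _ (hi _ hmem)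
      simp [w] at this
    · have := hwle _ _ _ (hi _ hx)
      simpa [w] using this
  obtain ⟨j, hjC, -⟩ := hdomG _ hsingle
  obtain ⟨x₀, hx₀, -⟩ := hlab j hjC
  set S : Finset G := {x | Sum.inl x ∈ σ} with hS
  have hSmem : ∀ x, x ∈ S ↔ Sum.inl x ∈ σ := fun x => by simp [hS]
  choose b hbS hb using fun i => S.exists_min_image (fun x => x.1 i) ⟨x₀, (hSmem x₀).2 hx₀⟩
  set m : ι → ℕ := fun i => (b i).1 i with hm
  have hmle : ∀ i, ∀ x ∈ S, m i ≤ x.1 i := hb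
  have hsum : ∀ x ∈ S, ∑ i ∈ C, x.1 i + ∑ i ∈ Finset.univ \ C, x.1 i = N := fun x _ => by
    rw [add_comm, Finset.sum_sdiff (Finset.subset_univ C)]
    exact (hG _).1 x.2
  have hmC : ∑ i ∈ C, m i ≤ N := by
    have h1 := hsum x₀ ((hSmem _).2 hx₀)
    have h2 := Finset.sum_le_sum fun i (_ : i ∈ C) => hmle i x₀ ((hSmem _).2 hx₀)
    omega
  have hCn : C.card ≤ Fintype.card ι := Finset.card_le_univ C
  have hfill : ∀ (f : ι → ℕ), ∑ i ∈ C, f i ≤ N →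
      ∑ i, ((if i ∈ C then f i else 0) + if i = j then N - ∑ i ∈ C, f i else 0) = N := by
    intro f hf
    rw [Finset.sum_add_distrib, Finset.sum_ite_mem, Finset.univ_inter, Finset.sum_ite_eq',
      if_pos (Finset.mem_univ j)]
    omega
  -- Otherwise `m + 1` on `C`, with the remainder put at `j`, is a grid point violating dominance.
  -- So cell points exceed `m` by less than `C.card` in total.
  have hbig : N < ∑ i ∈ C, m i + C.card := by
    by_contra! hN
    have hsm : ∑ i ∈ C, (m i + 1) ≤ N := by simpa [Finset.sum_add_distrib] using hN
    obtain ⟨i, hiC, hi⟩ := hdomG _ (hfill _ hsm)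
    have := hi (b i) ((hSmem _).1 (hbS i))
    simp only [hiC, if_true, hm] at this
    omega
  refine ⟨_, hfill m hmC, fun i hi => ?_⟩
  have hiC : i ∈ C := by
    by_contra hiC
    have : i ≠ j := fun h => hiC (h ▸ hjC)
    simp [hiC, this] at hi
  obtain ⟨x, hx, hxi⟩ := hlab i hiC
  have hxS := (hSmem x).2 hx
  refine ⟨x.1, (hG _).1 x.2, hxi, fun k => ?_⟩
  have h1 := hsum x hxS
  by_cases hk : k ∈ C
  · have h2 : ∑ i ∈ C.erase k, m i ≤ ∑ i ∈ C.erase k, x.1 i :=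
      Finset.sum_le_sum fun i _ => hmle i x hxS
    have h3 := Finset.add_sum_erase C m hk
    have h4 := Finset.add_sum_erase C x.1 hk
    have h5 := hmle k x hxS
    simp only [hk, if_true]
    split_ifs <;> omega
  · have hkj : k ≠ j := fun h => hk (h ▸ hjC)
    have h2 : ∑ i ∈ C, m i ≤ ∑ i ∈ C, x.1 i := Finset.sum_le_sum fun i _ => hmle i x hxS
    have h3 : x.1 k ≤ ∑ i ∈ Finset.univ \ C, x.1 i :=
      Finset.single_le_sum (f := x.1) (fun _ _ => Nat.zero_le _) (by simp [hk])
    simp only [hk, hkj, if_false]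
    omega

theorem natCast_div_mem_stdSimplex {N : ℕ} (hN : N ≠ 0) {x : ι → ℕ} (hx : ∑ i, x i = N) :
    (fun i => (x i : ℝ) / N) ∈ stdSimplex ℝ ι := by
  refine ⟨fun i => by positivity, ?_⟩
  rw [← Finset.sum_div, ← Nat.cast_sum, hx]
  exact div_self (Nat.cast_ne_zero.2 hN)

/-- In an open cover of the standard simplex indexed by its vertices, the members indexed by the
vertices of some face have a common point on that face. -/
theorem stdSimplex.exists_forall_mem_of_isOpen_cover [Nonempty ι] {U : ι → Set (stdSimplex ℝ ι)}
    (hU : ∀ i, IsOpen (U i)) (hcover : ∀ z, ∃ i, z ∈ U i) :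
    ∃ z : stdSimplex ℝ ι, ∀ i, z.1 i ≠ 0 → z ∈ U i := by
  classical
  cases subsingleton_or_nontrivial ι with
  | inl h =>
    obtain ⟨i₁⟩ := (inferInstance : Nonempty ι)
    obtain ⟨i, hi⟩ := hcover ⟨Pi.single i₁ 1, single_mem_stdSimplex ℝ i₁⟩
    exact ⟨_, fun k _ => Subsingleton.elim i k ▸ hi⟩
  | inr h =>
    obtain ⟨δ, hδ, hball⟩ := lebesgue_number_lemma_of_metric (isCompact_univ) hU
      (fun z _ => Set.mem_iUnion.2 (hcover z))
    choose lab hlab using fun z => hball z (Set.mem_univ z)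
    -- A shift by `Fintype.card ι` grid steps is then shorter than `δ`.
    obtain ⟨N, hN⟩ := exists_nat_gt ((Fintype.card ι : ℝ) / δ)
    have hNpos : (0 : ℝ) < N := lt_of_le_of_lt (by positivity) hN
    have hN0 : N ≠ 0 := Nat.cast_ne_zero.1 hNpos.ne'
    let g : (ι → ℕ) → ι := fun x => if hx : ∑ i, x i = N then
      lab ⟨_, natCast_div_mem_stdSimplex hN0 hx⟩ else Classical.arbitrary ι
    obtain ⟨z, hz, hnear⟩ := exists_grid_point_near_labels N g
    refine ⟨⟨_, natCast_div_mem_stdSimplex hN0 hz⟩, fun i hi => ?_⟩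
    have hzi : z i ≠ 0 := fun h => hi (by simp [h])
    obtain ⟨x, hx, rfl, hclose⟩ := hnear i hzi
    have hg : g x = lab ⟨_, natCast_div_mem_stdSimplex hN0 hx⟩ := dif_pos hx
    rw [hg]
    apply hlab
    rw [Metric.mem_ball, Subtype.dist_eq, dist_pi_lt_iff hδ]
    intro k
    obtain ⟨h1, h2⟩ := hclose k
    have h1' : (z k : ℝ) ≤ x k + Fintype.card ι := by exact_mod_cast h1
    have h2' : (x k : ℝ) ≤ z k + Fintype.card ι := by exact_mod_cast h2
    rw [Real.dist_eq, ← sub_div, abs_div, abs_of_pos hNpos]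
    calc |(z k : ℝ) - x k| / N ≤ Fintype.card ι / N := by
          gcongr
          rw [abs_le]
          constructor <;> linarith
      _ < δ := by
          rw [div_lt_iff₀ hδ] at hN
          rwa [div_lt_iff₀ hNpos, mul_comm]

end Simplex

/-! ### Fixed points of correspondences -/

/-- **Browder's fixed point theorem**: a correspondence on a compact convex set with nonempty convex
values and open lower sections has a fixed point. -/
theorem exists_mem_of_hasOpenLowerSections {E : Type*} [AddCommGroup E] [Module ℝ E]
    [TopologicalSpace E] [ContinuousAdd E] [ContinuousSMul ℝ E] {X : Set E} (hXne : X.Nonempty)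
    (hXconv : Convex ℝ X) (hXcomp : IsCompact X) {F : X → Set X} (hne : ∀ x, (F x).Nonempty)
    (hconv : ∀ x, Convex ℝ (Subtype.val '' F x)) (hF : HasOpenLowerSections F) :
    ∃ x, x ∈ F x := by
  have : CompactSpace X := isCompact_iff_compactSpace.1 hXcomp
  have hopen : ∀ y, IsOpen {x | y ∈ F x} := hasOpenLowerSections_iff_isOpen.1 hF
  obtain ⟨t, ht⟩ := isCompact_univ.elim_finite_subcover (fun y => {x | y ∈ F x}) hopen
    (fun x _ => Set.mem_iUnion.2 (hne x))
  have hcov : ∀ x, ∃ y : t, y.1 ∈ F x := fun x => by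
    obtain ⟨y, hy, hxy⟩ := Set.mem_iUnion₂.1 (ht (Set.mem_univ x))
    exact ⟨⟨y, hy⟩, hxy⟩
  obtain ⟨x₀, hx₀⟩ := hXne
  have : Nonempty t := (hcov ⟨x₀, hx₀⟩).nonempty
  let φ : stdSimplex ℝ t → X := fun z => ⟨∑ i, z.1 i • (i.1 : E),
    hXconv.sum_mem (fun i _ => z.2.1 i) z.2.2 (fun i _ => i.1.2)⟩
  have hφ : Continuous φ := by
    refine Continuous.subtype_mk (continuous_finsetSum _ fun i _ => ?_) _
    exact ((continuous_apply i).comp continuous_subtype_val).smul continuous_const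
  obtain ⟨z, hz⟩ := stdSimplex.exists_forall_mem_of_isOpen_cover
    (U := fun i : t => φ ⁻¹' {x | i.1 ∈ F x}) (fun i => (hopen i).preimage hφ)
    (fun z => hcov (φ z))
  refine ⟨φ z, ?_⟩
  have hmem : ((φ z : X) : E) ∈ Subtype.val '' F (φ z) := by
    -- Only the `i` in the support of `z` are known to give points of `F (φ z)`.
    have hsum : ((φ z : X) : E) = ∑ i with z.1 i ≠ 0, z.1 i • (i.1 : E) := by
      rw [Finset.sum_filter_of_ne]
      exact fun i _ h h0 => h (by rw [h0, zero_smul])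
    rw [hsum]
    refine (hconv _).sum_mem (fun i _ => z.2.1 i) ?_ fun i hi => ?_
    · rw [Finset.sum_filter_ne_zero]
      exact z.2.2
    · exact ⟨i.1, hz i (Finset.mem_filter.1 hi).2, rfl⟩
  obtain ⟨y, hy, hyx⟩ := hmem
  exact Subtype.ext hyx ▸ hy

theorem theorem2 {E : Type*} [AddCommGroup E] [Module ℝ E] [TopologicalSpace E]
    [IsTopologicalAddGroup E] [ContinuousSMul ℝ E] [LocallyConvexSpace ℝ E] [T2Space E]
    (X : Set E) (hXne : X.Nonempty) (hXconv : Convex ℝ X) (hXcomp : IsCompact X)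
    (A : X → Set X) (P : X × X → Set X)
    (hAne : ∀ x : X, (A x).Nonempty)
    (hAconv : ∀ x : X, ConvexIn (A x))
    (hAlower : HasOpenLowerSections A)
    (hne : ∀ x : X, ({y : X | A x ∩ P (x, y) = ∅} ∩ A x).Nonempty)
    (hconv : ∀ x : X, ConvexIn {y : X | A x ∩ P (x, y) = ∅})
    (hopen : ∀ y : X, IsOpen {x : X | A x ∩ P (x, y) = ∅}) :
    ∃ x : X, x ∈ A x ∧ A x ∩ P (x, x) = ∅ := by
  obtain ⟨x, hx, hxA⟩ := exists_mem_of_hasOpenLowerSections hXne hXconv hXcomp hne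
    (fun x => by
      rw [Set.image_inter Subtype.val_injective]
      exact (hconv x).inter (hAconv x))
    (hasOpenLowerSections_iff_isOpen.2 fun y =>
      (hopen y).inter (hasOpenLowerSections_iff_isOpen.1 hAlower y))
  exact ⟨x, hxA, hx⟩
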